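/- Let $0\le\theta_1,\theta_2,\theta_3,\theta_4\le\pi/4$, let $\theta=\min\{\theta_1,\theta_2,\theta_3,\theta_4\}$, and let $S_3(\theta_1,\theta_2,\theta_3,\theta_4)=\{|\psi_1\rangle,\dots,|\psi_9\rangle\}$ be the rotated domino basis of $\mathbb C^3\otimes\mathbb C^3$ (Alice holds the first factor, Bob the second; $|0\rangle,|1\rangle,|2\rangle$ is the standard basis of $\mathbb C^3$): $$\begin{aligned} |\psi_1\rangle&=|1\rangle|1\rangle,\\ |\psi_2\rangle&=|0\rangle(\cos\theta_1|0\rangle+\sin\theta_1|1\rangle), & |\psi_3\rangle&=|0\rangle(-\sin\theta_1|0\rangle+\cos\theta_1|1\rangle),\\ |\psi_4\rangle&=|2\rangle(\cos\theta_2|1\rangle+\sin\theta_2|2\rangle), & |\psi_5\rangle&=|2\rangle(-\sin\theta_2|1\rangle+\cos\theta_2|2\rangle),\\ |\psi_6\rangle&=(\cos\theta_3|1\rangle+\sin\theta_3|2\rangle)|0\rangle, & |\psi_7\rangle&=(-\sin\theta_3|1\rangle+\cos\theta_3|2\rangle)|0\rangle,\\ |\psi_8\rangle&=(\cos\theta_4|0\rangle+\sin\theta_4|1\rangle)|2\rangle,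 & |\psi_9\rangle&=(-\sin\theta_4|0\rangle+\cos\theta_4|1\rangle)|2\rangle. \end{aligned}$$ A (finite) LOCC protocol with outcomes $1,\dots,9$ is a finite tree. At each internal node one party applies to his or her own space a measurement given by finitely many operators $M_1,\dots,M_r$ into a space of some finite dimension with $\sum_i M_i^\dagger M_i=I$ (chosen depending on all previous outcomes) and communicates the outcome; each leaf $m$ is labelled by one of the outcomes $1,\dots,9$. If $A_m\otimes B_m$ is the product of the local operators applied along the branch to $m$, the protocol carries out the measurement with POVM elements $E_k=\sum_{m\text{ labelled }k}A_m^\dagger A_m\otimes B_m^\dagger B_m$. A measurement (POVM) $E=\{E_1,\dots,E_9\}$ on $\mathbb C^3\otimes\mathbb C^3$ is an LOCC measurement if some LOCC protocol has the same outcome distribution as $E$ on every input state; it can be implemented by asymptotic LOCC if the outcome distributions of some sequence of LOCC protocols converge to that of $E$ on every input state. (1) Any LOCC measurement for discriminating $S_3(\theta_1,\theta_2,\theta_3,\theta_4)$ errs with probability $$p_{\mathrm{error}}=\frac19\sum_{k=1}^9\sum_{j\ne k}\langle\psi_k|E_j|\psi_k\rangle\ \ge\ 2.4\times10^{-11}\,\sin^2(2\theta),$$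 where the state is drawn uniformly at random from the nine basis states. (2) Consequently the rotated domino states are nonlocal: if $\theta>0$, no measurement that can be implemented by asymptotic LOCC (in particular no LOCC measurement) discriminates the nine states perfectly, i.e. satisfies $\langle\psi_k|E_k|\psi_k\rangle=1$ for all $k$. -/

import Mathlib

open Filter Topology
open scoped Matrix Kronecker ComplexOrder

namespace LOCC

/-- A finite-round two-party LOCC protocol with outcomes in `K`, presented as a finite tree, where
`d` and `e` are the current dimensions of Alice's and Bob's state spaces. A leaf terminates the
protocol and announces an outcome. At every other node one of the parties applies to his or her
space a non-destructive measurement `M` with finitely many outcomes (`∑ i, (M i)ᴴ * M i = 1`),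
with an arbitrary finite output dimension, and communicates its outcome `i`; the protocol then
goes on with the `i`-th subtree, so that everything done later may depend on the whole
measurement record. Strict alternation is not required: it can be restored by letting a party
apply the trivial measurement `{1}`. -/
inductive Protocol (K : Type) : ℕ → ℕ → Type
  | leaf {d e : ℕ} (k : K) : Protocol K d e
  | alice {d e : ℕ} (r d' : ℕ) (M : Fin r → Matrix (Fin d') (Fin d) ℂ)
      (hM : ∑ i, (M i)ᴴ * M i = 1) (next : Fin r → Protocol K d' e) : Protocol K d e
  | bob {d e : ℕ} (r e' : ℕ) (M : Fin r → Matrix (Fin e') (Fin e) ℂ)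
      (hM : ∑ i, (M i)ᴴ * M i = 1) (next : Fin r → Protocol K d e') : Protocol K d e

/-- Given that the product operator `A ⊗ B` has already been implemented on the initial space
`ℂ^dA ⊗ ℂ^dB`, the sum of `AₘᴴAₘ ⊗ BₘᴴBₘ` over all terminating measurement records `m` with outcome
`k`, where `Aₘ ⊗ Bₘ` is the measurement operator implemented upon reaching the leaf `m`. -/
noncomputable def Protocol.effectFrom {K : Type} [DecidableEq K] {dA dB : ℕ} :
    {d e : ℕ} → Protocol K d e → Matrix (Fin d) (Fin dA) ℂ → Matrix (Fin e) (Fin dB) ℂ →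
      K → Matrix (Fin dA × Fin dB) (Fin dA × Fin dB) ℂ
  | _, _, .leaf k', A, B, k => if k' = k then (Aᴴ * A) ⊗ₖ (Bᴴ * B) else 0
  | _, _, .alice _ _ M _ next, A, B, k => ∑ i, (next i).effectFrom (M i * A) B k
  | _, _, .bob _ _ M _ next, A, B, k => ∑ i, (next i).effectFrom A (M i * B) k

/-- The POVM elements of the measurement carried out by a protocol. -/
noncomputable def Protocol.effect {K : Type} [DecidableEq K] {dA dB : ℕ}
    (P : Protocol K dA dB) (k : K) : Matrix (Fin dA × Fin dB) (Fin dA × Fin dB) ℂ :=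
  P.effectFrom 1 1 k

/-- `E` is a POVM measurement with outcomes in `K`. -/
def IsMeasurement {K ι : Type} [Fintype K] [Fintype ι] [DecidableEq ι]
    (E : K → Matrix ι ι ℂ) : Prop :=
  (∀ k, (E k).PosSemidef) ∧ ∑ k, E k = 1

/-- `ρ` is a density matrix. -/
def IsState {ι : Type} [Fintype ι] (ρ : Matrix ι ι ℂ) : Prop :=
  ρ.PosSemidef ∧ ρ.trace = 1

/-- The rank-one matrix `|ψ⟩⟨ψ|`. -/
def pure {ι : Type} (ψ : ι → ℂ) : Matrix ι ι ℂ :=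
  Matrix.vecMulVec ψ (star ψ)

/-- The probability `tr (E k ρ)` of outcome `k` when `E` is measured on `ρ`. -/
noncomputable def outcomeProb {K ι : Type} [Fintype ι] (E : K → Matrix ι ι ℂ)
    (ρ : Matrix ι ι ℂ) (k : K) : ℝ :=
  ((E k * ρ).trace).re

/-- `E` can be implemented by (finite) LOCC: some finite-round protocol has, on every input state,
the same distribution of outcomes as `E`. -/
def IsFiniteLOCC {K : Type} [DecidableEq K] {dA dB : ℕ}
    (E : K → Matrix (Fin dA × Fin dB) (Fin dA × Fin dB) ℂ) : Prop :=
  ∃ P : Protocol K dA dB, ∀ ρ, IsState ρ → ∀ k, outcomeProb P.effect ρ k = outcomeProb E ρ k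

/-- `E` can be implemented by asymptotic LOCC: the output distributions of some sequence of
finite-round protocols converge to that of `E`, on every input state. -/
def IsAsymptoticLOCC {K : Type} [DecidableEq K] {dA dB : ℕ}
    (E : K → Matrix (Fin dA × Fin dB) (Fin dA × Fin dB) ℂ) : Prop :=
  ∃ P : ℕ → Protocol K dA dB, ∀ ρ, IsState ρ → ∀ k,
    Tendsto (fun t => outcomeProb (P t).effect ρ k) atTop (𝓝 (outcomeProb E ρ k))

/-- The probability that the outcome of `E` differs from the index `k` when `k` is chosen uniformly
at random and `E` is measured on `ψ k`. -/
noncomputable def errorProb {K ι : Type} [Fintype K] [DecidableEq K] [Fintype ι]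
    (ψ : K → ι → ℂ) (E : K → Matrix ι ι ℂ) : ℝ :=
  ∑ k, (1 / (Fintype.card K : ℝ)) * ∑ j ∈ Finset.univ.erase k, outcomeProb E (pure (ψ k)) j

/-- `E` identifies each of the states `ψ k` with certainty. -/
def PerfectlyDiscriminates {K ι : Type} [Fintype ι]
    (ψ : K → ι → ℂ) (E : K → Matrix ι ι ℂ) : Prop :=
  ∀ k, outcomeProb E (pure (ψ k)) k = 1

/-- The product vector `|α⟩|β⟩`. -/
def tensor {d e : ℕ} (α : Fin d → ℂ) (β : Fin e → ℂ) : Fin d × Fin e → ℂ :=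
  fun p => α p.1 * β p.2

/-- The standard basis vector `|i⟩` of `ℂ³`. -/
def ket (i : Fin 3) : Fin 3 → ℂ := Pi.single i 1

/-- The vector `cos θ |i⟩ + sin θ |j⟩` of `ℂ³`. -/
noncomputable def rotCos (θ : ℝ) (i j : Fin 3) : Fin 3 → ℂ :=
  (Real.cos θ : ℂ) • ket i + (Real.sin θ : ℂ) • ket j

/-- The vector `- sin θ |i⟩ + cos θ |j⟩` of `ℂ³`. -/
noncomputable def rotSin (θ : ℝ) (i j : Fin 3) : Fin 3 → ℂ :=
  -(Real.sin θ : ℂ) • ket i + (Real.cos θ : ℂ) • ket j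

/-- The rotated domino basis of `ℂ³ ⊗ ℂ³`. -/
noncomputable def rotatedDomino (θ₁ θ₂ θ₃ θ₄ : ℝ) : Fin 9 → Fin 3 × Fin 3 → ℂ :=
  ![tensor (ket 1) (ket 1),
    tensor (ket 0) (rotCos θ₁ 0 1), tensor (ket 0) (rotSin θ₁ 0 1),
    tensor (ket 2) (rotCos θ₂ 1 2), tensor (ket 2) (rotSin θ₂ 1 2),
    tensor (rotCos θ₃ 1 2) (ket 0), tensor (rotSin θ₃ 1 2) (ket 0),
    tensor (rotCos θ₄ 0 1) (ket 2), tensor (rotSin θ₄ 0 1) (ket 2)]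

end LOCC

/-! At a node of a protocol where `A ⊗ B` has been applied, put `a = Aᴴ * A` and `b = Bᴴ * B`. At
the root all diagonal entries of `a` and `b` are equal. Call a node balanced if every diagonal entry
is at least 1/6 of the trace of its factor. The claim, proved by induction on the tree, is that
below a balanced node the error weight is at least `t * tr a * tr b` with `t = S ^ 2 / 10 ^ 8`, `S =
sin (2θ)`.

A balanced leaf announces one state while another still has appreciable weight (`le_errorProb_ite`).
If some diagonal entry is exactly 1/6 of its trace, the diagonal of that factor is far from
constant. Near-orthogonality of all pairs of states under `a ⊗ b` would force both diagonals to be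
nearly constant (`diag_close_of_nearly_orthogonal`), so some two states overlap noticeably and every
continuation, local or not, confuses them (`le_errorProb_of_slack_eq_zero`).

A measurement may jump across this boundary. For an outcome `a i` outside the region, mix it with
`s` copies of the operator before the measurement so that the sum lies on the boundary. The mixture
of the two continuations obeys the boundary bound, and summing over outcomes gives `1 + ∑ s` times
the desired inequality (`mul_trace_sum_le_errorProb`).

The resulting bound is uniform over protocols, so it survives limits and excludes perfect asymptotic
discrimination. -/

namespace LOCC

/-- The sesquilinear form `⟨u|X|v⟩`. -/
def form {ι : Type} [Fintype ι] (X : Matrix ι ι ℂ) (u v : ι → ℂ) : ℂ :=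
  star u ⬝ᵥ X *ᵥ v

/-! ### Positive semidefinite forms -/

section form
variable {ι : Type} [Fintype ι]

lemma form_add_left (X : Matrix ι ι ℂ) (u u' v : ι → ℂ) :
    form X (u + u') v = form X u v + form X u' v := by
  simp [form, add_dotProduct]

lemma form_add_right (X : Matrix ι ι ℂ) (u v v' : ι → ℂ) :
    form X u (v + v') = form X u v + form X u v' := by
  simp [form, Matrix.mulVec_add, dotProduct_add]

lemma form_smul_left (X : Matrix ι ι ℂ) (c : ℂ) (u v : ι → ℂ) :
    form X (c • u) v = star c * form X u v := by
  simp [form]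

lemma form_smul_right (X : Matrix ι ι ℂ) (c : ℂ) (u v : ι → ℂ) :
    form X u (c • v) = c * form X u v := by
  simp [form, Matrix.mulVec_smul]

lemma form_sum {K : Type} [Fintype K] (X : K → Matrix ι ι ℂ) (u v : ι → ℂ) :
    form (∑ k, X k) u v = ∑ k, form (X k) u v := by
  simp [form, Matrix.sum_mulVec, dotProduct_sum]

lemma outcomeProb_pure {K : Type} (E : K → Matrix ι ι ℂ) (ψ : ι → ℂ) (k : K) :
    outcomeProb E (pure ψ) k = (form (E k) ψ ψ).re := by
  rw [outcomeProb, pure, Matrix.mul_vecMulVec, Matrix.trace_vecMulVec, dotProduct_comm, form]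

lemma form_re_nonneg {X : Matrix ι ι ℂ} (hX : X.PosSemidef) (u : ι → ℂ) : 0 ≤ (form X u u).re :=
  (Complex.le_def.1 (hX.dotProduct_mulVec_nonneg u)).1

/-- The Cauchy-Schwarz inequality for a positive semidefinite form. -/
lemma norm_form_le {X : Matrix ι ι ℂ} (hX : X.PosSemidef) (u v : ι → ℂ) :
    ‖form X u v‖ ≤ √(form X u u).re * √(form X v v).re := by
  classical
  obtain ⟨C, rfl⟩ : ∃ C : Matrix ι ι ℂ, X = Cᴴ * C := by
    open scoped MatrixOrder in
    exact CStarAlgebra.nonneg_iff_eq_star_mul_self.1 hX.nonneg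
  have key (x y : ι → ℂ) : form (Cᴴ * C) x y =
      inner ℂ (WithLp.toLp 2 (C *ᵥ x)) (WithLp.toLp 2 (C *ᵥ y)) := by
    rw [EuclideanSpace.inner_eq_star_dotProduct, form, ← Matrix.mulVec_mulVec,
      Matrix.dotProduct_mulVec, Matrix.vecMul_conjTranspose, star_star, dotProduct_comm]
  have key' (x : ι → ℂ) : √(form (Cᴴ * C) x x).re = ‖WithLp.toLp 2 (C *ᵥ x)‖ := by
    rw [key, inner_self_eq_norm_sq_to_K]
    norm_cast
    exact Real.sqrt_sq (norm_nonneg _)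
  rw [key', key', key]
  exact norm_inner_le_norm _ _

end form

/-! ### Overlap of two states versus error probability -/

section pair
variable {K ι : Type} [Fintype K] [DecidableEq K] [Fintype ι]

/-- Split off the term `i`: since `i ≠ j`, the weight `g i` is among the errors of `g`, while all
other `f k` are errors of `f`. Cauchy-Schwarz bounds the remaining terms and then combines the two
pieces. -/
lemma sum_sqrt_mul_sqrt_sq_le {f g : K → ℝ} (hf : ∀ k, 0 ≤ f k) (hg : ∀ k, 0 ≤ g k) {i j : K}
    (hij : i ≠ j) :
    (∑ k, √(f k) * √(g k)) ^ 2 ≤ (∑ k, f k + ∑ k, g k) *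
      (∑ k ∈ Finset.univ.erase i, f k + ∑ k ∈ Finset.univ.erase j, g k) := by
  have ha : 0 ≤ ∑ k ∈ Finset.univ.erase i, f k := Finset.sum_nonneg fun k _ => hf k
  have hb : 0 ≤ ∑ k ∈ Finset.univ.erase j, g k := Finset.sum_nonneg fun k _ => hg k
  have hF : 0 ≤ ∑ k, f k := Finset.sum_nonneg fun k _ => hf k
  have hG : 0 ≤ ∑ k, g k := Finset.sum_nonneg fun k _ => hg k
  have h0 : 0 ≤ ∑ k, √(f k) * √(g k) := Finset.sum_nonneg fun k _ => by positivity
  have h1 : ∑ k, √(f k) * √(g k) ≤ √(∑ k, f k) * √(∑ k ∈ Finset.univ.erase j, g k) +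
      √(∑ k ∈ Finset.univ.erase i, f k) * √(∑ k, g k) := by
    rw [← Finset.add_sum_erase _ _ (Finset.mem_univ i)]
    refine add_le_add (mul_le_mul ?_ ?_ (Real.sqrt_nonneg _) (Real.sqrt_nonneg _)) ?_
    · exact Real.sqrt_le_sqrt (Finset.single_le_sum (fun k _ => hf k) (Finset.mem_univ i))
    · exact Real.sqrt_le_sqrt (Finset.single_le_sum (fun k _ => hg k)
        (Finset.mem_erase.2 ⟨hij, Finset.mem_univ i⟩))
    · refine (Real.sum_sqrt_mul_sqrt_le _ hf hg).trans ?_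
      refine mul_le_mul_of_nonneg_left (Real.sqrt_le_sqrt ?_) (Real.sqrt_nonneg _)
      exact Finset.sum_le_sum_of_subset_of_nonneg (Finset.subset_univ _) fun k _ _ => hg k
  have key (p q r t : ℝ) : (p * q + r * t) ^ 2 ≤ (p ^ 2 + t ^ 2) * (r ^ 2 + q ^ 2) := by
    nlinarith [sq_nonneg (p * r - q * t)]
  refine (pow_le_pow_left₀ h0 h1 2).trans ((key _ _ _ _).trans_eq ?_)
  rw [Real.sq_sqrt ha, Real.sq_sqrt hb, Real.sq_sqrt hF, Real.sq_sqrt hG]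

/-- If a positive operator is decomposed according to a guess of the state, then states with a
large overlap are frequently mistaken. -/
lemma norm_form_sum_sq_le {X : K → Matrix ι ι ℂ} (hX : ∀ k, (X k).PosSemidef) {i j : K}
    (hij : i ≠ j) (u v : ι → ℂ) :
    ‖form (∑ k, X k) u v‖ ^ 2 ≤
      ((form (∑ k, X k) u u).re + (form (∑ k, X k) v v).re) *
        (∑ k ∈ Finset.univ.erase i, (form (X k) u u).re +
          ∑ k ∈ Finset.univ.erase j, (form (X k) v v).re) := by
  have h := sum_sqrt_mul_sqrt_sq_le (fun k => form_re_nonneg (hX k) u)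
    (fun k => form_re_nonneg (hX k) v) hij
  rw [form_sum X u u, form_sum X v v, Complex.re_sum, Complex.re_sum]
  refine le_trans (pow_le_pow_left₀ (norm_nonneg _) ?_ 2) h
  rw [form_sum]
  exact (norm_sum_le _ _).trans (Finset.sum_le_sum fun k _ => norm_form_le (hX k) u v)

variable (ψ : K → ι → ℂ)

lemma card_mul_errorProb [Nonempty K] (X : K → Matrix ι ι ℂ) :
    Fintype.card K * errorProb ψ X =
      ∑ k, ∑ j ∈ Finset.univ.erase k, (form (X j) (ψ k) (ψ k)).re := by
  have : (Fintype.card K : ℝ) ≠ 0 := by simp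
  rw [errorProb, ← Finset.mul_sum]
  simp_rw [outcomeProb_pure]
  field_simp

lemma errorProb_nonneg {X : K → Matrix ι ι ℂ} (hX : ∀ k, (X k).PosSemidef) :
    0 ≤ errorProb ψ X := by
  unfold errorProb
  refine Finset.sum_nonneg fun k _ => mul_nonneg (by positivity) (Finset.sum_nonneg fun j _ => ?_)
  rw [outcomeProb_pure]
  exact form_re_nonneg (hX j) _

/-- `errorProb` is applied to arbitrary operator families, not only measurements: a branch of a
protocol carries its unnormalised weight, and linearity adds the branches. -/
lemma errorProb_sum {α : Type} [Fintype α] (X : α → K → Matrix ι ι ℂ) :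
    errorProb ψ (fun k => ∑ i, X i k) = ∑ i, errorProb ψ (X i) := by
  simp only [errorProb, outcomeProb_pure, form_sum, Complex.re_sum]
  rw [Finset.sum_comm]
  refine Finset.sum_congr rfl fun k _ => ?_
  rw [← Finset.mul_sum, Finset.sum_comm]

lemma errorProb_add_smul (X Y : K → Matrix ι ι ℂ) (s : ℝ) :
    errorProb ψ (fun k => X k + (s : ℂ) • Y k) = errorProb ψ X + s * errorProb ψ Y := by
  simp only [errorProb, outcomeProb_pure, form, Matrix.add_mulVec, Matrix.smul_mulVec,
    dotProduct_add, dotProduct_smul, Complex.add_re, smul_eq_mul, Complex.re_ofReal_mul,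
    Finset.sum_add_distrib, mul_add, Finset.mul_sum]
  congr 1
  refine Finset.sum_congr rfl fun k _ => Finset.sum_congr rfl fun j _ => ?_
  ring

lemma norm_form_sum_sq_le_errorProb [Nonempty K] {X : K → Matrix ι ι ℂ}
    (hX : ∀ k, (X k).PosSemidef) {i j : K} (hij : i ≠ j) :
    ‖form (∑ k, X k) (ψ i) (ψ j)‖ ^ 2 ≤
      ((form (∑ k, X k) (ψ i) (ψ i)).re + (form (∑ k, X k) (ψ j) (ψ j)).re) *
        (Fintype.card K * errorProb ψ X) := by
  refine (norm_form_sum_sq_le hX hij _ _).trans ?_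
  have hY := Matrix.posSemidef_sum Finset.univ fun k _ => hX k
  refine mul_le_mul_of_nonneg_left ?_
    (add_nonneg (form_re_nonneg hY _) (form_re_nonneg hY _))
  rw [card_mul_errorProb]
  exact Finset.add_le_sum
    (f := fun k => ∑ l ∈ Finset.univ.erase k, (form (X l) (ψ k) (ψ k)).re)
    (fun k _ => Finset.sum_nonneg fun l _ => form_re_nonneg (hX l) _)
    (Finset.mem_univ i) (Finset.mem_univ j) hij

end pair

/-! ### Positivity and completeness of the effects of a subtree -/

section effect
variable {K : Type} [DecidableEq K] {dA dB : ℕ}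

lemma Protocol.effectFrom_posSemidef {d e : ℕ} (P : Protocol K d e) (A : Matrix (Fin d) (Fin dA) ℂ)
    (B : Matrix (Fin e) (Fin dB) ℂ) (k : K) : (P.effectFrom A B k).PosSemidef := by
  induction P with
  | leaf k' =>
    rw [effectFrom]
    split_ifs
    · exact (Matrix.posSemidef_conjTranspose_mul_self A).kronecker
        (Matrix.posSemidef_conjTranspose_mul_self B)
    · exact .zero
  | alice r d' M hM next ih => exact Matrix.posSemidef_sum _ fun i _ => ih i _ _
  | bob r e' M hM next ih => exact Matrix.posSemidef_sum _ fun i _ => ih i _ _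

lemma sum_conjTranspose_mul_self {r m d n : ℕ} {M : Fin r → Matrix (Fin m) (Fin d) ℂ}
    (hM : ∑ i, (M i)ᴴ * M i = 1) (A : Matrix (Fin d) (Fin n) ℂ) :
    ∑ i, (M i * A)ᴴ * (M i * A) = Aᴴ * A := by
  calc ∑ i, (M i * A)ᴴ * (M i * A) = ∑ i, Aᴴ * ((M i)ᴴ * M i) * A := by
        simp [Matrix.conjTranspose_mul, Matrix.mul_assoc]
    _ = Aᴴ * A := by
        rw [← Matrix.sum_mul, ← Matrix.mul_sum, hM, Matrix.mul_one]

lemma kronecker_sum_left {α : Type} [Fintype α] (a : α → Matrix (Fin dA) (Fin dA) ℂ)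
    (b : Matrix (Fin dB) (Fin dB) ℂ) : ∑ i, a i ⊗ₖ b = (∑ i, a i) ⊗ₖ b := by
  ext p q
  simp [Matrix.sum_apply, Finset.sum_mul]

lemma kronecker_sum_right {α : Type} [Fintype α] (a : Matrix (Fin dA) (Fin dA) ℂ)
    (b : α → Matrix (Fin dB) (Fin dB) ℂ) : ∑ i, a ⊗ₖ b i = a ⊗ₖ (∑ i, b i) := by
  ext p q
  simp [Matrix.sum_apply, Finset.mul_sum]

/-- Completeness of each local measurement collapses the tree from the leaves up. The total depends
only on the operator at the root of the subtree, so a bound valid for all decompositions of that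
operator applies. -/
lemma Protocol.sum_effectFrom [Fintype K] {d e : ℕ} (P : Protocol K d e)
    (A : Matrix (Fin d) (Fin dA) ℂ) (B : Matrix (Fin e) (Fin dB) ℂ) :
    ∑ k, P.effectFrom A B k = (Aᴴ * A) ⊗ₖ (Bᴴ * B) := by
  induction P with
  | leaf k' => simp [effectFrom]
  | alice r d' M hM next ih =>
    simp only [effectFrom]
    rw [Finset.sum_comm]
    simp only [ih]
    rw [kronecker_sum_left, sum_conjTranspose_mul_self hM]
  | bob r e' M hM next ih =>
    simp only [effectFrom]
    rw [Finset.sum_comm]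
    simp only [ih]
    rw [kronecker_sum_right, sum_conjTranspose_mul_self hM]

end effect

/-! ### Interpolating to the boundary of the balanced region -/

section interpolation

/-- `6 aⱼⱼ - tr a`: it is nonnegative when outcome `j` of the computational basis measurement has
probability at least `1 / 6` in the state proportional to `a`. -/
noncomputable def slack {n : ℕ} (a : Matrix (Fin n) (Fin n) ℂ) (j : Fin n) : ℝ :=
  6 * (a j j).re - a.trace.re

lemma slack_add_smul {n : ℕ} (a b : Matrix (Fin n) (Fin n) ℂ) (s : ℝ) (j : Fin n) :
    slack (a + (s : ℂ) • b) j = slack a j + s * slack b j := by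
  simp only [slack, Matrix.add_apply, Matrix.smul_apply, Matrix.trace_add, Matrix.trace_smul,
    smul_eq_mul, Complex.add_re, Complex.re_ofReal_mul]
  ring

/-- Take `s` to be the largest ratio `-y j / x j`: the last coordinate to become nonnegative is then
exactly zero. -/
lemma exists_add_mul_nonneg {ι : Type} [Fintype ι] {x y : ι → ℝ} (hx : ∀ j, 0 < x j)
    (hy : ∃ j, y j < 0) :
    ∃ s : ℝ, 0 ≤ s ∧ (∀ j, 0 ≤ y j + s * x j) ∧ ∃ j, y j + s * x j = 0 := by
  obtain ⟨i, hi⟩ := hy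
  have : Nonempty ι := ⟨i⟩
  obtain ⟨j, -, hj⟩ := Finset.exists_max_image Finset.univ (fun j => -y j / x j)
    Finset.univ_nonempty
  have h k : -y k ≤ -y j / x j * x k := (div_le_iff₀ (hx k)).1 (hj k (Finset.mem_univ k))
  refine ⟨-y j / x j, ?_, fun k => by linarith [h k], j, ?_⟩
  · exact (div_pos (neg_pos.2 hi) (hx i)).le.trans (hj i (Finset.mem_univ i))
  · have := (hx j).ne'
    field_simp
    ring

variable {K ι : Type} [Fintype K] [DecidableEq K] [Fintype ι]

/-- A measurement that leaves the region where all `slack`s are nonnegative cannot be better than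
what is possible on the boundary of that region: a point of the boundary lies between the initial
operator `∑ i, a i` and the outcome `a i`, and there one may either proceed as after outcome `i` or
start afresh. -/
lemma mul_trace_sum_le_errorProb {r n : ℕ} (ψ : K → ι → ℂ)
    (F : Matrix (Fin n) (Fin n) ℂ → Matrix ι ι ℂ) (t : ℝ)
    (hF : ∀ x y (c : ℂ), F (x + c • y) = F x + c • F y)
    (bdry : ∀ x (X : K → Matrix ι ι ℂ), x.PosSemidef → (∀ k, (X k).PosSemidef) → ∑ k, X k = F x →
      (∀ j, 0 ≤ slack x j) → (∃ j, slack x j = 0) → t * x.trace.re ≤ errorProb ψ X)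
    {a : Fin r → Matrix (Fin n) (Fin n) ℂ} (ha : ∀ i, (a i).PosSemidef)
    {X : Fin r → K → Matrix ι ι ℂ} (hX : ∀ i k, (X i k).PosSemidef)
    (hXa : ∀ i, ∑ k, X i k = F (a i)) (hXsum : ∑ k, ∑ i, X i k = F (∑ i, a i))
    (hslack : ∀ j, 0 ≤ slack (∑ i, a i) j)
    (ih : ∀ i, (∀ j, 0 ≤ slack (a i) j) → t * (a i).trace.re ≤ errorProb ψ (X i)) :
    t * (∑ i, a i).trace.re ≤ errorProb ψ (fun k => ∑ i, X i k) := by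
  have hS : (∑ i, a i).PosSemidef := Matrix.posSemidef_sum _ fun i _ => ha i
  have hY k : (∑ i, X i k).PosSemidef := Matrix.posSemidef_sum _ fun i _ => hX i k
  by_cases h0 : ∃ j, slack (∑ i, a i) j = 0
  · exact bdry _ _ hS hY hXsum hslack h0
  push Not at h0
  have key i : ∃ s : ℝ, 0 ≤ s ∧ t * ((a i).trace.re + s * (∑ i, a i).trace.re) ≤
      errorProb ψ (X i) + s * errorProb ψ (fun k => ∑ i, X i k) := by
    by_cases hi : ∀ j, 0 ≤ slack (a i) j
    · exact ⟨0, le_rfl, by simpa using ih i hi⟩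
    push Not at hi
    obtain ⟨s, hs, hs0, hs1⟩ :=
      exists_add_mul_nonneg (fun j => (hslack j).lt_of_ne (h0 j).symm) hi
    have hs' : (0 : ℂ) ≤ (s : ℂ) := by exact_mod_cast hs
    refine ⟨s, hs, ?_⟩
    have := bdry (a i + (s : ℂ) • ∑ i, a i) (fun k => X i k + (s : ℂ) • ∑ i, X i k)
      ((ha i).add (hS.smul hs')) (fun k => (hX i k).add ((hY k).smul hs'))
      (by rw [Finset.sum_add_distrib, ← Finset.smul_sum, hXa, hXsum, hF])
      (by simpa only [slack_add_smul] using hs0) (by simpa only [slack_add_smul] using hs1)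
    rw [errorProb_add_smul] at this
    simpa [Matrix.trace_add, Matrix.trace_smul] using this
  choose s hs hs' using key
  have h := Finset.sum_le_sum fun i (_ : i ∈ Finset.univ) => hs' i
  rw [← Finset.mul_sum, Finset.sum_add_distrib, Finset.sum_add_distrib, ← Finset.sum_mul,
    ← Finset.sum_mul, ← errorProb_sum, ← Complex.re_sum, ← Matrix.trace_sum] at h
  have hs0 : 0 ≤ ∑ i, s i := Finset.sum_nonneg fun i _ => hs i
  -- `h` is the goal multiplied by `1 + ∑ i, s i`, which is positive.
  by_contra! hlt
  nlinarith [mul_nonneg hs0 (sub_nonneg.2 hlt.le)]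

end interpolation

/-! ### Matrix entries recovered from rotated pairs -/

section rotation
variable (m : Matrix (Fin 3) (Fin 3) ℂ) (φ : ℝ)

lemma form_ket (i j : Fin 3) : form m (ket i) (ket j) = m i j := by
  simp [form, ket]

lemma form_rotCos_rotCos_re_add (i j : Fin 3) :
    (form m (rotCos φ i j) (rotCos φ i j)).re + (form m (rotSin φ i j) (rotSin φ i j)).re =
      (m i i).re + (m j j).re := by
  simp only [rotCos, rotSin, form_add_left, form_add_right, form_smul_left, form_smul_right,
    form_ket, star_neg, RCLike.star_def, Complex.conj_ofReal, Complex.add_re, Complex.neg_re,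
    Complex.re_ofReal_mul, neg_mul]
  linear_combination ((m i i).re + (m j j).re) * Real.sin_sq_add_cos_sq φ

variable {m} in
-- The overlap of a rotated pair sees the difference of two diagonal entries with weight `sin (2φ) /
-- 2`; this is the source of the factor `sin² (2θ)` in the final bound.
lemma form_rotCos_rotSin_re (hm : m.IsHermitian) (i j : Fin 3) :
    (form m (rotCos φ i j) (rotSin φ i j)).re =
      Real.sin (2 * φ) / 2 * ((m j j).re - (m i i).re) + Real.cos (2 * φ) * (m i j).re := by
  have h : (m j i).re = (m i j).re := by rw [← hm.apply i j]; simp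
  simp only [rotCos, rotSin, form_add_left, form_add_right, form_smul_left, form_smul_right,
    form_ket, RCLike.star_def, Complex.conj_ofReal, Complex.add_re, Complex.neg_re,
    Complex.re_ofReal_mul, neg_mul, h, Real.sin_two_mul, Real.cos_two_mul']
  ring

lemma rot_combination (i j k : Fin 3) :
    Real.cos φ * form m (ket k) (rotCos φ i j) - Real.sin φ * form m (ket k) (rotSin φ i j) =
      m k i ∧
    Real.sin φ * form m (ket k) (rotCos φ i j) + Real.cos φ * form m (ket k) (rotSin φ i j) =
      m k j := by
  have h : (Real.sin φ : ℂ) ^ 2 + (Real.cos φ : ℂ) ^ 2 = 1 := by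
    exact_mod_cast Real.sin_sq_add_cos_sq φ
  simp only [rotCos, rotSin, form_add_right, form_smul_right, form_ket]
  exact ⟨by linear_combination m k i * h, by linear_combination m k j * h⟩

variable {m φ} in
-- Undoing the rotation expresses each entry through the two overlaps with coefficients of modulus
-- at most 1, hence the factor 2.
lemma norm_mul_apply_le_of_rot {z : ℂ} {D : ℝ} {i j k : Fin 3}
    (hc : ‖z * form m (ket k) (rotCos φ i j)‖ ≤ D) (hs : ‖z * form m (ket k) (rotSin φ i j)‖ ≤ D) :
    ‖z * m k i‖ ≤ 2 * D ∧ ‖z * m k j‖ ≤ 2 * D := by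
  have key (p q : ℝ) (x y : ℂ) (hp : |p| ≤ 1) (hq : |q| ≤ 1) (hx : ‖x‖ ≤ D) (hy : ‖y‖ ≤ D) :
      ‖p * x + q * y‖ ≤ 2 * D := by
    refine (norm_add_le _ _).trans ?_
    rw [norm_mul, norm_mul, Complex.norm_real, Complex.norm_real, Real.norm_eq_abs,
      Real.norm_eq_abs]
    nlinarith [mul_le_mul hp hx (norm_nonneg x) zero_le_one,
      mul_le_mul hq hy (norm_nonneg y) zero_le_one]
  obtain ⟨h1, h2⟩ := rot_combination m φ i j k
  constructor
  · convert key (Real.cos φ) (-Real.sin φ) _ _ (Real.abs_cos_le_one φ)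
      (by simpa using Real.abs_sin_le_one φ) hc hs using 2
    rw [← h1]
    push_cast
    ring
  · convert key (Real.sin φ) (Real.cos φ) _ _ (Real.abs_sin_le_one φ) (Real.abs_cos_le_one φ)
      hc hs using 2
    rw [← h2]
    ring

variable {m φ} in
-- Dividing by `p` and `q` costs a factor 6, leaving an overlap of at most `6Sβ/1000` and an
-- off-diagonal entry of at most `12Sβ/1000`. Together `(S/2)|x| ≤ 18Sβ/1000`.
lemma abs_diag_sub_le (hm : m.IsHermitian) {i j : Fin 3} {S α β : ℝ} (hS : 0 < S)
    (hSφ : S ≤ Real.sin (2 * φ)) (hα : 0 < α) {p q : ℂ} (hp : α ≤ 6 * p.re) (hq : α ≤ 6 * q.re)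
    (h1 : ‖p * form m (rotCos φ i j) (rotSin φ i j)‖ ≤ S * (α * β) / 1000)
    (h2 : ‖q * m i j‖ ≤ 2 * (S * (α * β) / 1000)) :
    |(m j j).re - (m i i).re| ≤ 36 / 1000 * β := by
  have aux {z w : ℂ} {c : ℝ} (hz : α ≤ 6 * z.re) (h : ‖z * w‖ ≤ c * (S * (α * β) / 1000)) :
      |w.re| ≤ 6 * c * S * β / 1000 := by
    rw [norm_mul] at h
    have hz' := Complex.re_le_norm z
    have hw := Complex.abs_re_le_norm w
    refine hw.trans (le_of_mul_le_mul_left ?_ hα)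
    nlinarith [norm_nonneg w]
  have h1' := aux (c := 1) hp (by simpa using h1)
  have h2' := aux hq h2
  rw [form_rotCos_rotSin_re φ hm] at h1'
  set x := (m j j).re - (m i i).re
  have hc : |Real.cos (2 * φ) * (m i j).re| ≤ 6 * 2 * S * β / 1000 := by
    rw [abs_mul]
    exact (mul_le_of_le_one_left (abs_nonneg _) (Real.abs_cos_le_one _)).trans h2'
  have h3 : |Real.sin (2 * φ) / 2 * x| ≤ 18 * S * β / 1000 := by
    rw [abs_le] at *
    constructor <;> linarith [h1'.1, h1'.2, hc.1, hc.2]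
  rw [abs_mul, abs_of_pos (by linarith)] at h3
  refine le_of_mul_le_mul_left ?_ hS
  nlinarith [abs_nonneg x]

end rotation

/-! ### Error bounds for the rotated domino states -/

section domino

lemma form_kronecker_tensor {d e : ℕ} (a : Matrix (Fin d) (Fin d) ℂ)
    (b : Matrix (Fin e) (Fin e) ℂ) (u u' : Fin d → ℂ) (v v' : Fin e → ℂ) :
    form (a ⊗ₖ b) (tensor u v) (tensor u' v') = form a u u' * form b v v' := by
  have h : (a ⊗ₖ b) *ᵥ tensor u' v' = tensor (a *ᵥ u') (b *ᵥ v') := by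
    ext p
    simp only [Matrix.mulVec, dotProduct, tensor, Fintype.sum_prod_type, Finset.sum_mul_sum,
      Matrix.kroneckerMap_apply]
    exact Finset.sum_congr rfl fun i _ => Finset.sum_congr rfl fun j _ => by ring
  rw [form, h]
  simp only [form, dotProduct, tensor, Fintype.sum_prod_type, Finset.sum_mul_sum, Pi.star_apply,
    star_mul']
  exact Finset.sum_congr rfl fun i _ => Finset.sum_congr rfl fun j _ => by ring

lemma form_im_eq_zero {ι : Type} [Fintype ι] {X : Matrix ι ι ℂ} (hX : X.PosSemidef) (u : ι → ℂ) :
    (form X u u).im = 0 :=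
  (Complex.le_def.1 (hX.dotProduct_mulVec_nonneg u)).2.symm

lemma form_kronecker_tensor_re {d e : ℕ} {a : Matrix (Fin d) (Fin d) ℂ}
    (b : Matrix (Fin e) (Fin e) ℂ) (ha : a.PosSemidef) (u : Fin d → ℂ) (v : Fin e → ℂ) :
    (form (a ⊗ₖ b) (tensor u v) (tensor u v)).re = (form a u u).re * (form b v v).re := by
  rw [form_kronecker_tensor, Complex.mul_re, form_im_eq_zero ha]
  ring

lemma trace_re_eq (m : Matrix (Fin 3) (Fin 3) ℂ) :
    m.trace.re = (m 0 0).re + (m 1 1).re + (m 2 2).re := by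
  simp [Matrix.trace_fin_three]

lemma diag_re_nonneg {n : ℕ} {m : Matrix (Fin n) (Fin n) ℂ} (hm : m.PosSemidef) (j : Fin n) :
    0 ≤ (m j j).re :=
  (Complex.le_def.1 (hm.diag_nonneg (i := j))).1

lemma trace_re_nonneg {n : ℕ} {m : Matrix (Fin n) (Fin n) ℂ} (hm : m.PosSemidef) :
    0 ≤ m.trace.re :=
  (Complex.le_def.1 hm.trace_nonneg).1

lemma form_ket_re_le {m : Matrix (Fin 3) (Fin 3) ℂ} (hm : m.PosSemidef) (i : Fin 3) :
    (form m (ket i) (ket i)).re ≤ m.trace.re := by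
  rw [form_ket, trace_re_eq]
  have := diag_re_nonneg hm
  fin_cases i <;> simp <;> linarith [this 0, this 1, this 2]

lemma form_rot_re_le {m : Matrix (Fin 3) (Fin 3) ℂ} (hm : m.PosSemidef) (φ : ℝ) {i j : Fin 3}
    (hij : i ≠ j) : (form m (rotCos φ i j) (rotCos φ i j)).re ≤ m.trace.re ∧
      (form m (rotSin φ i j) (rotSin φ i j)).re ≤ m.trace.re := by
  have h := form_rotCos_rotCos_re_add m φ i j
  have hc := form_re_nonneg hm (rotCos φ i j)
  have hs := form_re_nonneg hm (rotSin φ i j)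
  have h' : (m i i).re + (m j j).re ≤ m.trace.re := by
    rw [Matrix.trace, Complex.re_sum]
    exact Finset.add_le_sum (f := fun k => (m k k).re) (fun k _ => diag_re_nonneg hm k)
      (Finset.mem_univ i) (Finset.mem_univ j) hij
  constructor <;> linarith

variable (θ₁ θ₂ θ₃ θ₄ : ℝ) {a b : Matrix (Fin 3) (Fin 3) ℂ}

lemma form_rotatedDomino_re_le (ha : a.PosSemidef) (hb : b.PosSemidef) (k : Fin 9) :
    (form (a ⊗ₖ b) (rotatedDomino θ₁ θ₂ θ₃ θ₄ k) (rotatedDomino θ₁ θ₂ θ₃ θ₄ k)).re ≤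
      a.trace.re * b.trace.re := by
  have key (u v : Fin 3 → ℂ) (hu : (form a u u).re ≤ a.trace.re)
      (hv : (form b v v).re ≤ b.trace.re) :
      (form (a ⊗ₖ b) (tensor u v) (tensor u v)).re ≤ a.trace.re * b.trace.re := by
    rw [form_kronecker_tensor_re b ha]
    exact mul_le_mul hu hv (form_re_nonneg hb v) (trace_re_nonneg ha)
  have k1 := form_ket_re_le ha
  have k2 := form_ket_re_le hb
  have r1 φ {i j} := @form_rot_re_le a ha φ i j
  have r2 φ {i j} := @form_rot_re_le b hb φ i j
  fin_cases k
  · exact key _ _ (k1 _) (k2 _)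
  · exact key _ _ (k1 _) (r2 _ (by decide)).1
  · exact key _ _ (k1 _) (r2 _ (by decide)).2
  · exact key _ _ (k1 _) (r2 _ (by decide)).1
  · exact key _ _ (k1 _) (r2 _ (by decide)).2
  · exact key _ _ (r1 _ (by decide)).1 (k2 _)
  · exact key _ _ (r1 _ (by decide)).2 (k2 _)
  · exact key _ _ (r1 _ (by decide)).1 (k2 _)
  · exact key _ _ (r1 _ (by decide)).2 (k2 _)

variable {θ₁ θ₂ θ₃ θ₄}

/-- If the rotated domino states stay nearly orthogonal under `a ⊗ b`, then the diagonal entries of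
each of the two factors nearly agree. -/
lemma diag_close_of_nearly_orthogonal (ha : a.PosSemidef) (hb : b.PosSemidef)
    (hsa : ∀ j, 0 ≤ slack a j) (hsb : ∀ j, 0 ≤ slack b j)
    (hα : 0 < a.trace.re) (hβ : 0 < b.trace.re) {S : ℝ} (hS : 0 < S)
    (hS₁ : S ≤ Real.sin (2 * θ₁)) (hS₂ : S ≤ Real.sin (2 * θ₂))
    (hS₃ : S ≤ Real.sin (2 * θ₃)) (hS₄ : S ≤ Real.sin (2 * θ₄))
    (H : ∀ i j, i ≠ j → ‖form (a ⊗ₖ b) (rotatedDomino θ₁ θ₂ θ₃ θ₄ i)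
      (rotatedDomino θ₁ θ₂ θ₃ θ₄ j)‖ ≤ S * (a.trace.re * b.trace.re) / 1000) :
    (|(a 1 1).re - (a 0 0).re| ≤ 36 / 1000 * a.trace.re ∧
      |(a 2 2).re - (a 1 1).re| ≤ 36 / 1000 * a.trace.re) ∧
    (|(b 1 1).re - (b 0 0).re| ≤ 36 / 1000 * b.trace.re ∧
      |(b 2 2).re - (b 1 1).re| ≤ 36 / 1000 * b.trace.re) := by
  have hwa j : a.trace.re ≤ 6 * (a j j).re := sub_nonneg.1 (hsa j)
  have hwb j : b.trace.re ≤ 6 * (b j j).re := sub_nonneg.1 (hsb j)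
  have herm {m : Matrix (Fin 3) (Fin 3) ℂ} (hm : m.PosSemidef) (z : ℂ) (i j : Fin 3) :
      ‖z * m i j‖ = ‖z * m j i‖ := by
    rw [norm_mul, norm_mul, ← hm.1.apply i j, norm_star]
  set D := S * (a.trace.re * b.trace.re) / 1000
  have hD : D = S * (b.trace.re * a.trace.re) / 1000 := by simp only [D]; ring
  have h12 : ‖form (a ⊗ₖ b) (tensor (ket 0) (rotCos θ₁ 0 1)) (tensor (ket 0) (rotSin θ₁ 0 1))‖
    ≤ D := H 1 2 (by decide)
  have h34 : ‖form (a ⊗ₖ b) (tensor (ket 2) (rotCos θ₂ 1 2)) (tensor (ket 2) (rotSin θ₂ 1 2))‖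
    ≤ D := H 3 4 (by decide)
  have h56 : ‖form (a ⊗ₖ b) (tensor (rotCos θ₃ 1 2) (ket 0)) (tensor (rotSin θ₃ 1 2) (ket 0))‖
    ≤ D := H 5 6 (by decide)
  have h78 : ‖form (a ⊗ₖ b) (tensor (rotCos θ₄ 0 1) (ket 2)) (tensor (rotSin θ₄ 0 1) (ket 2))‖
    ≤ D := H 7 8 (by decide)
  have h1 : ‖form (a ⊗ₖ b) (tensor (ket 1) (ket 1)) (tensor (ket 0) (rotCos θ₁ 0 1))‖ ≤ D :=
    H 0 1 (by decide)
  have h2 : ‖form (a ⊗ₖ b) (tensor (ket 1) (ket 1)) (tensor (ket 0) (rotSin θ₁ 0 1))‖ ≤ D :=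
    H 0 2 (by decide)
  have h3 : ‖form (a ⊗ₖ b) (tensor (ket 1) (ket 1)) (tensor (ket 2) (rotCos θ₂ 1 2))‖ ≤ D :=
    H 0 3 (by decide)
  have h4 : ‖form (a ⊗ₖ b) (tensor (ket 1) (ket 1)) (tensor (ket 2) (rotSin θ₂ 1 2))‖ ≤ D :=
    H 0 4 (by decide)
  have h5 : ‖form (a ⊗ₖ b) (tensor (ket 1) (ket 1)) (tensor (rotCos θ₃ 1 2) (ket 0))‖ ≤ D :=
    H 0 5 (by decide)
  have h6 : ‖form (a ⊗ₖ b) (tensor (ket 1) (ket 1)) (tensor (rotSin θ₃ 1 2) (ket 0))‖ ≤ D :=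
    H 0 6 (by decide)
  have h7 : ‖form (a ⊗ₖ b) (tensor (ket 1) (ket 1)) (tensor (rotCos θ₄ 0 1) (ket 2))‖ ≤ D :=
    H 0 7 (by decide)
  have h8 : ‖form (a ⊗ₖ b) (tensor (ket 1) (ket 1)) (tensor (rotSin θ₄ 0 1) (ket 2))‖ ≤ D :=
    H 0 8 (by decide)
  simp only [form_kronecker_tensor, form_ket] at h12 h34 h56 h78 h1 h2 h3 h4 h5 h6 h7 h8
  rw [mul_comm] at h5 h6 h7 h8 h56 h78
  refine ⟨⟨?_, ?_⟩, ?_, ?_⟩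
  -- Each difference combines the overlap within one rotated pair with an off-diagonal entry,
  -- bounded through the overlaps of `|1⟩|1⟩` with a pair rotated in the other factor.
  · refine abs_diag_sub_le ha.1 hS hS₄ hβ (hwb 2) (hwb 1) (h78.trans_eq hD) ?_
    rw [herm ha, mul_comm, ← hD]
    exact (norm_mul_apply_le_of_rot h1 h2).2
  · refine abs_diag_sub_le ha.1 hS hS₃ hβ (hwb 0) (hwb 1) (h56.trans_eq hD) ?_
    rw [mul_comm, ← hD]
    exact (norm_mul_apply_le_of_rot h3 h4).1
  · refine abs_diag_sub_le hb.1 hS hS₁ hα (hwa 0) (hwa 1) h12 ?_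
    rw [herm hb, mul_comm]
    exact (norm_mul_apply_le_of_rot h5 h6).1
  · refine abs_diag_sub_le hb.1 hS hS₂ hα (hwa 2) (hwa 1) h34 ?_
    rw [mul_comm]
    exact (norm_mul_apply_le_of_rot h7 h8).2

/-- An entry equal to 1/6 of the trace would put the other two within 0.036 or 0.072 of 1/6, so the
three could not add up to the trace. -/
lemma not_diag_close {m : Matrix (Fin 3) (Fin 3) ℂ} (hm : 0 < m.trace.re)
    (h : ∃ j, slack m j = 0) :
    ¬ (|(m 1 1).re - (m 0 0).re| ≤ 36 / 1000 * m.trace.re ∧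
      |(m 2 2).re - (m 1 1).re| ≤ 36 / 1000 * m.trace.re) := by
  rintro ⟨h1, h2⟩
  obtain ⟨j, hj⟩ := h
  rw [abs_le] at h1 h2
  have ht := trace_re_eq m
  rw [slack] at hj
  fin_cases j <;> simp at hj <;> linarith [h1.1, h1.2, h2.1, h2.2]

/-- On the boundary of the region where all `slack`s are nonnegative, no measurement, local or not,
discriminates well. -/
lemma le_errorProb_of_slack_eq_zero (ha : a.PosSemidef) (hb : b.PosSemidef)
    (hsa : ∀ j, 0 ≤ slack a j) (hsb : ∀ j, 0 ≤ slack b j)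
    (h0 : (∃ j, slack a j = 0) ∨ ∃ j, slack b j = 0) {S : ℝ} (hS : 0 ≤ S)
    (hS₁ : S ≤ Real.sin (2 * θ₁)) (hS₂ : S ≤ Real.sin (2 * θ₂))
    (hS₃ : S ≤ Real.sin (2 * θ₃)) (hS₄ : S ≤ Real.sin (2 * θ₄))
    {X : Fin 9 → Matrix (Fin 3 × Fin 3) (Fin 3 × Fin 3) ℂ} (hX : ∀ k, (X k).PosSemidef)
    (hXab : ∑ k, X k = a ⊗ₖ b) :
    S ^ 2 / 10 ^ 8 * (a.trace.re * b.trace.re) ≤ errorProb (rotatedDomino θ₁ θ₂ θ₃ θ₄) X := by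
  have he := errorProb_nonneg (rotatedDomino θ₁ θ₂ θ₃ θ₄) hX
  rcases hS.eq_or_lt with rfl | hS
  · simpa using he
  rcases (trace_re_nonneg ha).eq_or_lt with hα | hα
  · simpa [← hα] using he
  rcases (trace_re_nonneg hb).eq_or_lt with hβ | hβ
  · simpa [← hβ] using he
  by_contra! hlt
  have hT : 0 < a.trace.re * b.trace.re := mul_pos hα hβ
  have h := diag_close_of_nearly_orthogonal ha hb hsa hsb hα hβ hS hS₁ hS₂ hS₃ hS₄ fun i j hij => by
    have h1 := norm_form_sum_sq_le_errorProb (rotatedDomino θ₁ θ₂ θ₃ θ₄) hX hij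
    rw [hXab] at h1
    have h2 := add_le_add (form_rotatedDomino_re_le θ₁ θ₂ θ₃ θ₄ ha hb i)
      (form_rotatedDomino_re_le θ₁ θ₂ θ₃ θ₄ ha hb j)
    set T := a.trace.re * b.trace.re
    -- The squared overlap is at most `2T · 9 · S²T/10⁸ = 18 S²T²/10⁸`, below `(ST/1000)² = 100
    -- S²T²/10⁸`.
    refine abs_le_of_sq_le_sq' (h1.trans ?_) (by positivity) |>.2
    refine (mul_le_mul h2 (mul_le_mul_of_nonneg_left hlt.le (by positivity)) (by positivity)
      (by positivity)).trans ?_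
    rw [Fintype.card_fin]
    have : 0 ≤ S ^ 2 * T ^ 2 := by positivity
    push_cast
    nlinarith
  exact h0.elim (fun h0 => not_diag_close hα h0 h.1) fun h0 => not_diag_close hβ h0 h.2

lemma card_mul_errorProb_ite {K ι : Type} [Fintype K] [DecidableEq K] [Nonempty K] [Fintype ι]
    (ψ : K → ι → ℂ) (Y : Matrix ι ι ℂ) (k' : K) :
    Fintype.card K * errorProb ψ (fun k => if k' = k then Y else 0) =
      ∑ k ∈ Finset.univ.erase k', (form Y (ψ k) (ψ k)).re := by
  have h (k : K) : ∑ j ∈ Finset.univ.erase k,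
      (form (if k' = j then Y else 0) (ψ k) (ψ k)).re =
        if k ≠ k' then (form Y (ψ k) (ψ k)).re else 0 := by
    have (j : K) : (form (if k' = j then Y else 0) (ψ k) (ψ k)).re =
        if k' = j then (form Y (ψ k) (ψ k)).re else 0 := by
      split_ifs <;> simp [form]
    simp [this, eq_comm]
  rw [card_mul_errorProb]
  simp_rw [h]
  rw [← Finset.sum_filter, Finset.filter_ne']

/-- Inside the region where all `slack`s are nonnegative, no state can be announced with
certainty. -/
lemma le_errorProb_ite (ha : a.PosSemidef) (hb : b.PosSemidef)
    (hsa : ∀ j, 0 ≤ slack a j) (hsb : ∀ j, 0 ≤ slack b j) (k' : Fin 9) :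
    a.trace.re * b.trace.re / 324 ≤
      errorProb (rotatedDomino θ₁ θ₂ θ₃ θ₄) (fun k => if k' = k then a ⊗ₖ b else 0) := by
  have hα := trace_re_nonneg ha
  have hβ := trace_re_nonneg hb
  have hwa j : a.trace.re / 6 ≤ (a j j).re := by linarith [sub_nonneg.1 (hsa j)]
  have hwb j : b.trace.re / 6 ≤ (b j j).re := by linarith [sub_nonneg.1 (hsb j)]
  have hw i j : a.trace.re * b.trace.re / 36 ≤ (a i i).re * (b j j).re := by
    have := mul_le_mul (hwa i) (hwb j) (by positivity) (diag_re_nonneg ha i)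
    linarith
  have hY := ha.kronecker hb
  have key : a.trace.re * b.trace.re / 36 ≤ ∑ k ∈ Finset.univ.erase k',
      (form (a ⊗ₖ b) (rotatedDomino θ₁ θ₂ θ₃ θ₄ k) (rotatedDomino θ₁ θ₂ θ₃ θ₄ k)).re := by
    -- If `|1⟩|1⟩` is announced, the pair `ψ₂, ψ₃` has total weight `a₀₀(b₀₀ + b₁₁)`; otherwise
    -- `|1⟩|1⟩` itself is missed. Dividing 1/36 by the nine states gives 1/324.
    by_cases hk : k' = 0
    · subst hk
      refine le_trans ?_ (Finset.add_le_sum (f := fun k => (form (a ⊗ₖ b)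
        (rotatedDomino θ₁ θ₂ θ₃ θ₄ k) (rotatedDomino θ₁ θ₂ θ₃ θ₄ k)).re)
        (fun k _ => form_re_nonneg hY _) (i := 1) (j := 2) (by decide) (by decide) (by decide))
      change _ ≤ (form (a ⊗ₖ b) (tensor (ket 0) (rotCos θ₁ 0 1))
        (tensor (ket 0) (rotCos θ₁ 0 1))).re + (form (a ⊗ₖ b) (tensor (ket 0) (rotSin θ₁ 0 1))
        (tensor (ket 0) (rotSin θ₁ 0 1))).re
      rw [form_kronecker_tensor_re b ha, form_kronecker_tensor_re b ha, ← mul_add,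
        form_rotCos_rotCos_re_add, form_ket, mul_add]
      linarith [hw 0 0, mul_nonneg (diag_re_nonneg ha 0) (diag_re_nonneg hb 1)]
    · refine le_trans ?_ (Finset.single_le_sum (f := fun k => (form (a ⊗ₖ b)
        (rotatedDomino θ₁ θ₂ θ₃ θ₄ k) (rotatedDomino θ₁ θ₂ θ₃ θ₄ k)).re)
        (fun k _ => form_re_nonneg hY _)
        (Finset.mem_erase.2 ⟨Ne.symm hk, Finset.mem_univ (0 : Fin 9)⟩))
      change _ ≤ (form (a ⊗ₖ b) (tensor (ket 1) (ket 1)) (tensor (ket 1) (ket 1))).re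
      rw [form_kronecker_tensor_re b ha, form_ket, form_ket]
      exact hw 1 1
  rw [← card_mul_errorProb_ite, Fintype.card_fin] at key
  push_cast at key
  linarith

end domino

/-! ### Induction over the protocol tree and normalisation -/

section protocol
variable {θ₁ θ₂ θ₃ θ₄ S : ℝ}

/-- Only the factor of the measuring party changes at a node, so the interpolation is run in that
factor with the other fixed. The induction hypothesis is needed only for outcomes that stay
balanced. -/
lemma Protocol.le_errorProb_effectFrom (hS : 0 ≤ S) (hS' : S ≤ 1)
    (hS₁ : S ≤ Real.sin (2 * θ₁)) (hS₂ : S ≤ Real.sin (2 * θ₂))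
    (hS₃ : S ≤ Real.sin (2 * θ₃)) (hS₄ : S ≤ Real.sin (2 * θ₄))
    {d e : ℕ} (P : Protocol (Fin 9) d e)
    (A : Matrix (Fin d) (Fin 3) ℂ) (B : Matrix (Fin e) (Fin 3) ℂ)
    (hA : ∀ j, 0 ≤ slack (Aᴴ * A) j) (hB : ∀ j, 0 ≤ slack (Bᴴ * B) j) :
    S ^ 2 / 10 ^ 8 * ((Aᴴ * A).trace.re * (Bᴴ * B).trace.re) ≤
      errorProb (rotatedDomino θ₁ θ₂ θ₃ θ₄) (P.effectFrom A B) := by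
  have hps {n : ℕ} (C : Matrix (Fin n) (Fin 3) ℂ) : (Cᴴ * C).PosSemidef :=
    Matrix.posSemidef_conjTranspose_mul_self C
  induction P with
  | leaf k' =>
    refine le_trans ?_ (le_errorProb_ite (hps A) (hps B) hA hB k')
    have := mul_nonneg (trace_re_nonneg (hps A)) (trace_re_nonneg (hps B))
    nlinarith [pow_le_one₀ hS hS' (n := 2)]
  | alice r d' M hM next ih =>
    have h := mul_trace_sum_le_errorProb (rotatedDomino θ₁ θ₂ θ₃ θ₄) (fun a => a ⊗ₖ (Bᴴ * B))
      (S ^ 2 / 10 ^ 8 * (Bᴴ * B).trace.re)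
      (fun x y c => by simp [Matrix.add_kronecker, Matrix.smul_kronecker])
      (fun x X hx hX hXx hs h0 => by
        rw [mul_assoc, mul_comm (Bᴴ * B).trace.re]
        exact le_errorProb_of_slack_eq_zero hx (hps B) hs hB (.inl h0) hS hS₁ hS₂ hS₃ hS₄ hX hXx)
      (a := fun i => (M i * A)ᴴ * (M i * A)) (fun i => hps _)
      (X := fun i => (next i).effectFrom (M i * A) B)
      (fun i => effectFrom_posSemidef _ _ _) (fun i => sum_effectFrom _ _ _)
      (by
        rw [sum_conjTranspose_mul_self hM]
        exact (Protocol.alice r d' M hM next).sum_effectFrom A B)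
      (by rwa [sum_conjTranspose_mul_self hM])
      (fun i hi => by
        rw [mul_assoc, mul_comm (Bᴴ * B).trace.re]
        exact ih i _ _ hi hB)
    rw [sum_conjTranspose_mul_self hM, mul_assoc, mul_comm (Bᴴ * B).trace.re] at h
    exact h
  | bob r e' M hM next ih =>
    have h := mul_trace_sum_le_errorProb (rotatedDomino θ₁ θ₂ θ₃ θ₄) (fun b => (Aᴴ * A) ⊗ₖ b)
      (S ^ 2 / 10 ^ 8 * (Aᴴ * A).trace.re)
      (fun x y c => by simp [Matrix.kronecker_add, Matrix.kronecker_smul])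
      (fun x X hx hX hXx hs h0 => by
        rw [mul_assoc]
        exact le_errorProb_of_slack_eq_zero (hps A) hx hA hs (.inr h0) hS hS₁ hS₂ hS₃ hS₄ hX hXx)
      (a := fun i => (M i * B)ᴴ * (M i * B)) (fun i => hps _)
      (X := fun i => (next i).effectFrom A (M i * B))
      (fun i => effectFrom_posSemidef _ _ _) (fun i => sum_effectFrom _ _ _)
      (by
        rw [sum_conjTranspose_mul_self hM]
        exact (Protocol.bob r e' M hM next).sum_effectFrom A B)
      (by rwa [sum_conjTranspose_mul_self hM])
      (fun i hi => by
        rw [mul_assoc]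
        exact ih i _ _ hA hi)
    rw [sum_conjTranspose_mul_self hM, mul_assoc] at h
    exact h

lemma Protocol.le_errorProb_effect (hS : 0 ≤ S) (hS' : S ≤ 1)
    (hS₁ : S ≤ Real.sin (2 * θ₁)) (hS₂ : S ≤ Real.sin (2 * θ₂))
    (hS₃ : S ≤ Real.sin (2 * θ₃)) (hS₄ : S ≤ Real.sin (2 * θ₄)) (P : Protocol (Fin 9) 3 3) :
    9 / 10 ^ 8 * S ^ 2 ≤ errorProb (rotatedDomino θ₁ θ₂ θ₃ θ₄) P.effect := by
  have hslack j : 0 ≤ slack ((1 : Matrix (Fin 3) (Fin 3) ℂ)ᴴ * 1) j := by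
    norm_num [slack]
  have h := P.le_errorProb_effectFrom hS hS' hS₁ hS₂ hS₃ hS₄ 1 1 hslack hslack
  have ht : ((1 : Matrix (Fin 3) (Fin 3) ℂ)ᴴ * 1).trace.re = 3 := by simp
  rw [ht] at h
  exact le_trans (by linarith) h

lemma form_one_tensor {d e : ℕ} (u : Fin d → ℂ) (v : Fin e → ℂ) :
    form 1 (tensor u v) (tensor u v) = form 1 u u * form 1 v v := by
  rw [← Matrix.one_kronecker_one, form_kronecker_tensor]

lemma form_one_rotatedDomino (k : Fin 9) :
    form 1 (rotatedDomino θ₁ θ₂ θ₃ θ₄ k) (rotatedDomino θ₁ θ₂ θ₃ θ₄ k) = 1 := by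
  have hk (i : Fin 3) : form 1 (ket i) (ket i) = 1 := by simp [form_ket]
  have hn (φ : ℝ) : (Real.sin φ : ℂ) ^ 2 + (Real.cos φ : ℂ) ^ 2 = 1 := by
    exact_mod_cast Real.sin_sq_add_cos_sq φ
  have hr (φ : ℝ) {i j : Fin 3} (hij : i ≠ j) : form 1 (rotCos φ i j) (rotCos φ i j) = 1 ∧
      form 1 (rotSin φ i j) (rotSin φ i j) = 1 := by
    simp only [rotCos, rotSin, form_add_left, form_add_right, form_smul_left, form_smul_right,
      form_ket, star_neg, RCLike.star_def, Complex.conj_ofReal, Matrix.one_apply_eq,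
      Matrix.one_apply_ne hij, Matrix.one_apply_ne hij.symm]
    constructor <;> linear_combination hn φ
  have key (u v : Fin 3 → ℂ) (hu : form 1 u u = 1) (hv : form 1 v v = 1) :
      form 1 (tensor u v) (tensor u v) = 1 := by
    rw [form_one_tensor, hu, hv, one_mul]
  fin_cases k
  · exact key _ _ (hk _) (hk _)
  · exact key _ _ (hk _) (hr _ (by decide)).1
  · exact key _ _ (hk _) (hr _ (by decide)).2
  · exact key _ _ (hk _) (hr _ (by decide)).1
  · exact key _ _ (hk _) (hr _ (by decide)).2
  · exact key _ _ (hr _ (by decide)).1 (hk _)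
  · exact key _ _ (hr _ (by decide)).2 (hk _)
  · exact key _ _ (hr _ (by decide)).1 (hk _)
  · exact key _ _ (hr _ (by decide)).2 (hk _)

lemma isState_pure {ι : Type} [Fintype ι] [DecidableEq ι] {ψ : ι → ℂ} (h : form 1 ψ ψ = 1) :
    IsState (pure ψ) := by
  refine ⟨Matrix.posSemidef_vecMulVec_self_star ψ, ?_⟩
  rw [pure, Matrix.trace_vecMulVec, dotProduct_comm]
  simpa [form] using h

lemma errorProb_eq_zero_of_perfectlyDiscriminates {K ι : Type} [Fintype K] [DecidableEq K]
    [Fintype ι] [DecidableEq ι] {ψ : K → ι → ℂ} (hψ : ∀ k, form 1 (ψ k) (ψ k) = 1)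
    {E : K → Matrix ι ι ℂ} (hE : IsMeasurement E) (h : PerfectlyDiscriminates ψ E) :
    errorProb ψ E = 0 := by
  refine Finset.sum_eq_zero fun k _ => ?_
  have h1 : ∑ j, outcomeProb E (pure (ψ k)) j = 1 := by
    simp_rw [outcomeProb_pure]
    rw [← Complex.re_sum, ← form_sum, hE.2, hψ, Complex.one_re]
  rw [← Finset.add_sum_erase _ _ (Finset.mem_univ k), h k] at h1
  rw [add_eq_left.1 h1, mul_zero]

end protocol

end LOCC

theorem mainTheorem2 (θ₁ θ₂ θ₃ θ₄ θ : ℝ)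
    (h₁ : θ₁ ∈ Set.Icc 0 (Real.pi / 4)) (h₂ : θ₂ ∈ Set.Icc 0 (Real.pi / 4))
    (h₃ : θ₃ ∈ Set.Icc 0 (Real.pi / 4)) (h₄ : θ₄ ∈ Set.Icc 0 (Real.pi / 4))
    (hθ : θ = min (min θ₁ θ₂) (min θ₃ θ₄)) :
    (∀ E : Fin 9 → Matrix (Fin 3 × Fin 3) (Fin 3 × Fin 3) ℂ,
      LOCC.IsMeasurement E → LOCC.IsFiniteLOCC E →
        (2.4 * 10 ^ (-11 : ℤ) : ℝ) * Real.sin (2 * θ) ^ 2 ≤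
          LOCC.errorProb (LOCC.rotatedDomino θ₁ θ₂ θ₃ θ₄) E) ∧
    (0 < θ → ∀ E : Fin 9 → Matrix (Fin 3 × Fin 3) (Fin 3 × Fin 3) ℂ,
      LOCC.IsMeasurement E → LOCC.IsAsymptoticLOCC E →
        ¬ LOCC.PerfectlyDiscriminates (LOCC.rotatedDomino θ₁ θ₂ θ₃ θ₄) E) := by
  have hθ0 : 0 ≤ θ := hθ ▸ le_min (le_min h₁.1 h₂.1) (le_min h₃.1 h₄.1)
  have hle {φ : ℝ} (hφ : φ ∈ Set.Icc 0 (Real.pi / 4)) (h : θ ≤ φ) :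
      Real.sin (2 * θ) ≤ Real.sin (2 * φ) :=
    Real.sin_le_sin_of_le_of_le_pi_div_two (by linarith [Real.pi_pos]) (by linarith [hφ.2])
      (by linarith)
  have hθ₁ : θ ≤ θ₁ := by simp [hθ]
  have hθ₂ : θ ≤ θ₂ := by simp [hθ]
  have hθ₃ : θ ≤ θ₃ := by simp [hθ]
  have hθ₄ : θ ≤ θ₄ := by simp [hθ]
  have hpi : 2 * θ < Real.pi := by linarith [h₁.2, Real.pi_pos]
  have hS : 0 ≤ Real.sin (2 * θ) := Real.sin_nonneg_of_nonneg_of_le_pi (by linarith) hpi.le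
  have key := LOCC.Protocol.le_errorProb_effect hS (Real.sin_le_one _) (hle h₁ hθ₁) (hle h₂ hθ₂)
    (hle h₃ hθ₃) (hle h₄ hθ₄)
  have hpure (k : Fin 9) : LOCC.IsState (LOCC.pure (LOCC.rotatedDomino θ₁ θ₂ θ₃ θ₄ k)) :=
    LOCC.isState_pure (LOCC.form_one_rotatedDomino k)
  constructor
  · rintro E - ⟨P, hP⟩
    have hEP : LOCC.errorProb (LOCC.rotatedDomino θ₁ θ₂ θ₃ θ₄) P.effect =
        LOCC.errorProb (LOCC.rotatedDomino θ₁ θ₂ θ₃ θ₄) E := by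
      simp only [LOCC.errorProb, hP _ (hpure _)]
    rw [← hEP]
    refine le_trans (mul_le_mul_of_nonneg_right ?_ (sq_nonneg _)) (key P)
    norm_num
  · rintro hpos E hE ⟨P, hP⟩ hperf
    have hlim : Tendsto (fun t => LOCC.errorProb (LOCC.rotatedDomino θ₁ θ₂ θ₃ θ₄) (P t).effect)
        atTop (𝓝 (LOCC.errorProb (LOCC.rotatedDomino θ₁ θ₂ θ₃ θ₄) E)) :=
      tendsto_finsetSum _ fun k _ => (tendsto_finsetSum _ fun j _ => hP _ (hpure k) j).const_mul _
    -- `errorProb` involves finitely many states and outcomes, so pointwise convergence carries the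
    -- uniform bound to the limit, where perfect discrimination would make it zero.
    have h := ge_of_tendsto' hlim fun t => key (P t)
    rw [LOCC.errorProb_eq_zero_of_perfectlyDiscriminates LOCC.form_one_rotatedDomino hE hperf] at h
    have : 0 < Real.sin (2 * θ) := Real.sin_pos_of_pos_of_lt_pi (by linarith) hpi
    have : 0 < 9 / 10 ^ 8 * Real.sin (2 * θ) ^ 2 := by positivity
    linarith
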